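/- **Setting.** Let $V$ and $W$ be connected Hausdorff $C^\infty$ manifolds of the same dimension $n$, each with a $C^1$ metric $\mathbf g$ of Lorentzian signature $(+,-,\dots,-)$ and a time orientation given by a continuous timelike vector field $\xi$. A tangent vector $v$ is *future-directed* if $\mathbf g(v,v)\ge 0$ and $\mathbf g(\xi,v)>0$, and *timelike* if $\mathbf g(v,v)>0$. Write $V\prec W$ ("$W$ is causally related with $V$") if there is a $C^\infty$ diffeomorphism $\Phi:V\to W$ such that $\Phi' X$ is future-directed for every future-directed $X\in T(V)$. **Curves.** A timelike curve is a piecewise $C^1$ curve (finitely many arcs on closed intervals) whose tangent vectors, one-sided ones at corners included, are future-directed and timelike. A causal curve is a continuous curve $\gamma$ on an interval such that for every parameter $t$ and every neighbourhood $U$ of $\gamma(t)$, for all $t_1<t_2$ sufficiently close to $t$ there is a $C^1$ arc in $U$ with future-directed tangent vectors from $\gamma(t_1)$ to $\gamma(t_2)$. A point $x$ is a past (future) endpoint of $\gamma$ if for every neighbourhood $U$ of $x$ there is a parameter $t_0$ with $\gamma(t)\in U$ for all $t\le t_0$ ($t\ge t_0$); $\gamma$ is past (future) endless if it has no past (future)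 endpoint. $I^{+}(x)$ is the set of points reached from $x$ by a timelike curve, $J^{+}(x)$ consists of $x$ and the points reached from $x$ by a causal curve on an interval $[a,b]$, $a<b$; $I^-$, $J^-$ are defined dually, and $I^\pm(x,U)$ uses timelike curves in $U$. $D^{+}(S)$ is the set of $x$ such that every past-endless causal curve through $x$ meets $S$; $D^-(S)$ is defined dually with future-endless curves, and $D(S)=D^+(S)\cup D^-(S)$. A set $S$ is acausal if no causal curve on an interval $[a,b]$, $a<b$, starts and ends in $S$. The edge of $S$ is the set of $x\in\overline S$ such that every neighbourhood $U$ of $x$ contains $p\in I^-(x,U)$ and $q\in I^+(x,U)$ joined by a timelike curve in $U\setminus S$. **Causality conditions.** A manifold $V$ as above is - *not totally vicious* if $I^+(x)\cap I^-(x)\ne V$ for all $x$; - *chronological* if $x\notin I^+(x)$ for all $x$; - *causal* if $J^+(x)\cap J^-(x)=\{x\}$ for all $x$; - *distinguishing* if $I^+(x)=I^+(y)$ implies $x=y$, and $I^-(x)=I^-(y)$ implies $x=y$; - *strongly causal* if every neighbourhood of every point $x$ contains a neighbourhood $U$ of $x$ such that $\gamma\cap U$ is empty or connected for every causal curve $\gamma$;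 - *causally stable* if there is a smooth function on $V$ whose gradient is everywhere timelike; - *globally hyperbolic* if there is an acausal (topological, locally flat) hypersurface $S$ with empty edge and $D(S)=V$. **Theorem.** If $V\prec W$ and $W$ is globally hyperbolic (respectively causally stable, strongly causal, distinguishing, causal, chronological, not totally vicious), then so is $V$. Consequently, if $W$ satisfies one of these seven conditions and $V$ does not, then $V\not\prec W$. -/

import Mathlib

open Set Bundle
open scoped Manifold ContDiff Topology

noncomputable section

/-- A time-oriented Lorentzian structure on a smooth manifold `V` of dimension `n`: a `C^1` metric
of signature `(+,-,…,-)` and a continuous timelike vector field giving the time orientation. -/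
structure Spacetime (n : ℕ) (V : Type*) [TopologicalSpace V]
    [ChartedSpace (EuclideanSpace ℝ (Fin n)) V] [IsManifold (𝓡 n) ∞ V] where
  /-- the metric tensor -/
  metric : ∀ x : V, TangentSpace (𝓡 n) x →L[ℝ] TangentSpace (𝓡 n) x →L[ℝ] ℝ
  symm : ∀ (x : V) (v w : TangentSpace (𝓡 n) x), metric x v w = metric x w v
  /-- signature `(+,-,…,-)`: some positive vector has a negative definite orthogonal complement -/
  lorentzian : ∀ x : V, ∃ v : TangentSpace (𝓡 n) x, 0 < metric x v v ∧
    ∀ w : TangentSpace (𝓡 n) x, metric x v w = 0 → w ≠ 0 → metric x w w < 0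
  contMDiff_metric : ContMDiff (𝓡 n)
    ((𝓡 n).prod 𝓘(ℝ, EuclideanSpace ℝ (Fin n) →L[ℝ] EuclideanSpace ℝ (Fin n) →L[ℝ] ℝ)) 1
    (fun x ↦ TotalSpace.mk' (EuclideanSpace ℝ (Fin n) →L[ℝ] EuclideanSpace ℝ (Fin n) →L[ℝ] ℝ)
      (E := fun y : V ↦ TangentSpace (𝓡 n) y →L[ℝ] TangentSpace (𝓡 n) y →L[ℝ] ℝ) x (metric x))
  /-- the vector field defining the time orientation -/
  timeField : ∀ x : V, TangentSpace (𝓡 n) x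
  timelike_timeField : ∀ x : V, 0 < metric x (timeField x) (timeField x)
  continuous_timeField :
    Continuous (fun x ↦ (⟨x, timeField x⟩ : TangentBundle (𝓡 n) V))

namespace Spacetime

variable {n : ℕ} {V : Type*} [TopologicalSpace V]
  [ChartedSpace (EuclideanSpace ℝ (Fin n)) V] [IsManifold (𝓡 n) ∞ V] (g : Spacetime n V)

/-! ### Vectors -/

/-- Future-directed (causal) tangent vectors. -/
def IsFuture {x : V} (v : TangentSpace (𝓡 n) x) : Prop :=
  0 ≤ g.metric x v v ∧ 0 < g.metric x (g.timeField x) v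

/-- Future-directed timelike tangent vectors. -/
def IsFutureTimelike {x : V} (v : TangentSpace (𝓡 n) x) : Prop :=
  0 < g.metric x v v ∧ 0 < g.metric x (g.timeField x) v

/-! ### Curves -/

/-- The tangent vector at time `t` of a curve restricted to `[a, b]`
(one-sided at the end points). -/
def velocity (n : ℕ) {V : Type*} [TopologicalSpace V]
    [ChartedSpace (EuclideanSpace ℝ (Fin n)) V] (γ : ℝ → V) (a b t : ℝ) :
    TangentSpace (𝓡 n) (γ t) :=
  mfderivWithin 𝓘(ℝ, ℝ) (𝓡 n) γ (Icc a b) t (1 : ℝ)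

/-- `γ` restricted to `[a, b]` is a `C^1` future-directed causal arc. -/
def IsCausalArc (γ : ℝ → V) (a b : ℝ) : Prop :=
  a < b ∧ ContMDiffOn 𝓘(ℝ, ℝ) (𝓡 n) 1 γ (Icc a b) ∧
    ∀ t ∈ Icc a b, g.IsFuture (velocity n γ a b t)

/-- `γ` restricted to `[a, b]` is a `C^1` future-directed timelike arc. -/
def IsTimelikeArc (γ : ℝ → V) (a b : ℝ) : Prop :=
  a < b ∧ ContMDiffOn 𝓘(ℝ, ℝ) (𝓡 n) 1 γ (Icc a b) ∧
    ∀ t ∈ Icc a b, g.IsFutureTimelike (velocity n γ a b t)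

/-- `γ` restricted to `[a, b]` is a piecewise `C^1` future-directed timelike curve:
`[a, b]` is cut at `a = τ 0 < τ 1 < ⋯ < τ k = b` into finitely many timelike arcs. -/
def IsTimelikeCurve (γ : ℝ → V) (a b : ℝ) : Prop :=
  a < b ∧ ∃ (k : ℕ) (τ : ℕ → ℝ), τ 0 = a ∧ τ k = b ∧
    ∀ i < k, g.IsTimelikeArc γ (τ i) (τ (i + 1))

/-- `γ` restricted to the interval `s` is a continuous future-directed causal curve: locally along
the curve, and inside arbitrarily small open sets, an earlier point is joined to a later one by a
`C^1` future-directed causal arc. -/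
def IsCausalCurve (γ : ℝ → V) (s : Set ℝ) : Prop :=
  s.OrdConnected ∧ ContinuousOn γ s ∧
    ∀ t ∈ s, ∀ U ∈ 𝓝 (γ t), ∃ ε > 0, ∀ t₁ ∈ s, ∀ t₂ ∈ s,
      |t₁ - t| < ε → |t₂ - t| < ε → t₁ < t₂ →
        ∃ (c : ℝ → V) (a b : ℝ), g.IsCausalArc c a b ∧ c a = γ t₁ ∧ c b = γ t₂ ∧
          MapsTo c (Icc a b) U

/-- `x` is a past endpoint of the curve `γ` on `s`. -/
def IsPastEndpoint (γ : ℝ → V) (s : Set ℝ) (x : V) : Prop :=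
  ∀ U ∈ 𝓝 x, ∃ t₀ ∈ s, ∀ t ∈ s, t ≤ t₀ → γ t ∈ U

/-- `x` is a future endpoint of the curve `γ` on `s`. -/
def IsFutureEndpoint (γ : ℝ → V) (s : Set ℝ) (x : V) : Prop :=
  ∀ U ∈ 𝓝 x, ∃ t₀ ∈ s, ∀ t ∈ s, t₀ ≤ t → γ t ∈ U

/-! ### Causal relations -/

/-- `p` is joined to `q` by a future-directed timelike curve contained in `U`. -/
def ChronIn (U : Set V) (p q : V) : Prop :=
  ∃ (γ : ℝ → V) (a b : ℝ), g.IsTimelikeCurve γ a b ∧ γ a = p ∧ γ b = q ∧ MapsTo γ (Icc a b) U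

/-- `p` is joined to `q` by a (nondegenerate) continuous future-directed causal curve. -/
def CausallyJoined (p q : V) : Prop :=
  ∃ (γ : ℝ → V) (a b : ℝ), a < b ∧ g.IsCausalCurve γ (Icc a b) ∧ γ a = p ∧ γ b = q

/-- Chronological future `I⁺(p)`. -/
def chronFuture (p : V) : Set V := {q | g.ChronIn univ p q}

/-- Chronological past `I⁻(p)`. -/
def chronPast (p : V) : Set V := {q | g.ChronIn univ q p}

/-- Causal future `J⁺(p)`; it contains `p`. -/
def causalFuture (p : V) : Set V := {q | p = q ∨ g.CausallyJoined p q}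

/-- Causal past `J⁻(p)`; it contains `p`. -/
def causalPast (p : V) : Set V := {q | q = p ∨ g.CausallyJoined q p}

/-- Future Cauchy development `D⁺(A)`: every past-endless causal curve through `x` meets `A`. -/
def futureDevelopment (A : Set V) : Set V :=
  {x | ∀ (γ : ℝ → V) (s : Set ℝ), g.IsCausalCurve γ s → (¬ ∃ y, IsPastEndpoint γ s y) →
    (∃ t ∈ s, γ t = x) → ∃ t ∈ s, γ t ∈ A}

/-- Past Cauchy development `D⁻(A)`: every future-endless causal curve through `x` meets `A`. -/
def pastDevelopment (A : Set V) : Set V :=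
  {x | ∀ (γ : ℝ → V) (s : Set ℝ), g.IsCausalCurve γ s → (¬ ∃ y, IsFutureEndpoint γ s y) →
    (∃ t ∈ s, γ t = x) → ∃ t ∈ s, γ t ∈ A}

/-- Total domain of dependence `D(A) = D⁺(A) ∪ D⁻(A)`. -/
def development (A : Set V) : Set V := g.futureDevelopment A ∪ g.pastDevelopment A

/-- No causal curve goes from a point of `S` to a point of `S` (in particular, no closed causal
curve passes through `S`). -/
def IsAcausal (S : Set V) : Prop := ∀ p ∈ S, ∀ q ∈ S, ¬ g.CausallyJoined p q

/-- The edge of an achronal set `S`: the points `x` of its closure every neighbourhood `U` of which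
contains points `p ∈ I⁻(x, U)` and `q ∈ I⁺(x, U)` joined by a timelike curve in `U` that does not
meet `S`. -/
def edge (S : Set V) : Set V :=
  {x ∈ closure S | ∀ U ∈ 𝓝 x, ∃ p q : V,
    g.ChronIn U p x ∧ g.ChronIn U x q ∧ g.ChronIn (U \ S) p q}

/-- `S` is a (topological, locally flat) hypersurface of the `n`-manifold `V`: near each of its
points some topological chart of `V` straightens `S` to a hyperplane. -/
def IsHypersurface (n : ℕ) {V : Type*} [TopologicalSpace V] (S : Set V) : Prop :=
  ∀ x ∈ S, ∃ (e : OpenPartialHomeomorph V (EuclideanSpace ℝ (Fin n)))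
    (H : Submodule ℝ (EuclideanSpace ℝ (Fin n))),
    x ∈ e.source ∧ Module.finrank ℝ H + 1 = n ∧ e '' (e.source ∩ S) = e.target ∩ H

/-! ### The causality conditions -/

def NotTotallyVicious : Prop := ∀ x : V, g.chronFuture x ∩ g.chronPast x ≠ univ

def Chronological : Prop := ∀ x : V, x ∉ g.chronFuture x

def Causal : Prop := ∀ x : V, g.causalFuture x ∩ g.causalPast x = {x}

def FutureDistinguishing : Prop := ∀ x y : V, g.chronFuture x = g.chronFuture y → x = y

def PastDistinguishing : Prop := ∀ x y : V, g.chronPast x = g.chronPast y → x = y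

def Distinguishing : Prop := g.FutureDistinguishing ∧ g.PastDistinguishing

/-- Every neighbourhood of every point contains a neighbourhood whose intersection with each
future-directed causal curve is empty or connected. -/
def StronglyCausal : Prop :=
  ∀ x : V, ∀ N ∈ 𝓝 x, ∃ U ∈ 𝓝 x, U ⊆ N ∧
    ∀ (γ : ℝ → V) (s : Set ℝ), g.IsCausalCurve γ s →
      γ '' s ∩ U = ∅ ∨ IsConnected (γ '' s ∩ U)

/-- `v` is the gradient of `f` at `x`. -/
def IsGradientAt (f : V → ℝ) (x : V) (v : TangentSpace (𝓡 n) x) : Prop :=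
  ∀ w : TangentSpace (𝓡 n) x, g.metric x v w = mfderiv (𝓡 n) 𝓘(ℝ, ℝ) f x w

/-- There is a smooth function with everywhere timelike gradient. -/
def CausallyStable : Prop :=
  ∃ f : V → ℝ, ContMDiff (𝓡 n) 𝓘(ℝ, ℝ) ∞ f ∧
    ∀ x : V, ∃ v : TangentSpace (𝓡 n) x, g.IsGradientAt f x v ∧ 0 < g.metric x v v

/-- There is an edgeless acausal hypersurface `S` with `D(S) = V`. -/
def GloballyHyperbolic : Prop :=
  ∃ S : Set V, IsHypersurface n S ∧ g.IsAcausal S ∧ g.edge S = ∅ ∧ g.development S = univ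

/-! ### Causal mappings -/

/-- `V ≺ W`: some diffeomorphism `V → W` maps future-directed vectors to future-directed ones. -/
def Precedes {W : Type*} [TopologicalSpace W]
    [ChartedSpace (EuclideanSpace ℝ (Fin n)) W] [IsManifold (𝓡 n) ∞ W]
    (h : Spacetime n W) : Prop :=
  ∃ Φ : V ≃ₘ^∞⟮𝓡 n, 𝓡 n⟯ W, ∀ (x : V) (v : TangentSpace (𝓡 n) x),
    g.IsFuture v → h.IsFuture (x := Φ x) (mfderiv (𝓡 n) (𝓡 n) Φ x v)

end Spacetime

end

/-! A diffeomorphism preserving future-directed vectors maps causal curves to causal curves. It also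
preserves future-directed timelike vectors: such a vector remains future-directed after subtracting
a small multiple of a preimage of the time field, so its image is the sum of a future-directed
vector and a positive multiple of the time field, hence timelike. Thus timelike curves are mapped to
timelike curves as well, and most of the conditions are pulled back directly.

Two conditions need more. Causal stability is pulled back along `f ↦ f ∘ Φ` because a gradient is
timelike exactly when the differential vanishes on no future-directed vector. For the distinguishing
condition, `I⁺(x) ⊆ I⁺(y)` gives `I⁺(Φ x) ⊆ I⁺(Φ y)` because `I⁻(z)` is open: if `z ∈ I⁺(Φ x)`, then
also `z ∈ I⁺(Φ x')` for some `x' ∈ I⁺(x)` near `x`. -/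

namespace Spacetime

noncomputable section

/-- A bilinear form of Lorentzian signature `(+,-,…,-)`. -/
structure IsLorentzian {K E : Type*} [Field K] [LinearOrder K] [AddCommGroup E] [Module K E]
    (B : LinearMap.BilinForm K E) : Prop where
  isSymm : B.IsSymm
  exists_negDef_orthogonal : ∃ v, 0 < B v v ∧ ∀ w, B v w = 0 → w ≠ 0 → B w w < 0

section BilinForm

variable {K E : Type*} [Field K] [LinearOrder K] [AddCommGroup E] [Module K E]
  {B : LinearMap.BilinForm K E}

theorem IsLorentzian.nondegenerate (hB : IsLorentzian B) : B.Nondegenerate := by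
  obtain ⟨v, -, hv⟩ := hB.exists_negDef_orthogonal
  refine hB.isSymm.isRefl.nondegenerate_iff_separatingLeft.2 fun u hu ↦ ?_
  by_contra hu0
  exact (hv u (by rw [hB.isSymm.eq, hu]) hu0).ne (hu u)

variable [IsStrictOrderedRing K]

theorem IsLorentzian.apply_ne_zero (hB : IsLorentzian B) {u w : E} (hu : 0 < B u u)
    (hw : 0 ≤ B w w) (hw0 : w ≠ 0) : B u w ≠ 0 := by
  intro huw
  have hwu : B w u = 0 := by rw [hB.isSymm.eq, huw]
  obtain ⟨v, -, hv⟩ := hB.exists_negDef_orthogonal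
  have hvu : B v u ≠ 0 := fun hvu ↦
    (hv u hvu fun hu0 ↦ by simp [hu0] at hu).not_gt hu
  -- `z` spans the line in which the plane of `u` and `w` meets the complement of `v`.
  set z := B v u • w - B v w • u with hz
  have hvz : B v z = 0 := by simp [hz, mul_comm]
  have huz : B u z = -(B v w * B u u) := by simp [hz, huw]
  have hzz : B z z = B v u ^ 2 * B w w + B v w ^ 2 * B u u := by
    simp only [hz, map_sub, map_smul, LinearMap.sub_apply, LinearMap.smul_apply, smul_eq_mul,
      huw, hwu]
    ring
  have hz0 : z = 0 := by
    by_contra hz0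
    exact (hv z hvz hz0).not_ge (hzz ▸ by positivity)
  have hvw : B v w = 0 := by simpa [hz0, hu.ne'] using huz
  rw [hz0, hvw, zero_smul, sub_zero, eq_comm, smul_eq_zero] at hz
  exact hz.elim hvu hw0

/-- The vector `B u e • u - B u u • e`, orthogonal to `u`, does it unless `u` is orthogonal to `e`,
in which case `e` does. -/
theorem exists_nonneg_orthogonal (hB : B.IsSymm) {e u : E} (he : 0 < B e e) (hu : B u u ≤ 0) :
    ∃ w, 0 ≤ B w w ∧ 0 < B e w ∧ B u w = 0 := by
  by_cases hue : B u e = 0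
  · exact ⟨e, he.le, he, hue⟩
  have hdisc : B u u * B e e < B u e ^ 2 :=
    (mul_nonpos_of_nonpos_of_nonneg hu he.le).trans_lt (by positivity)
  refine ⟨B u e • u - B u u • e, ?_, ?_, ?_⟩
  · calc 0 ≤ -B u u * (B u e ^ 2 - B u u * B e e) :=
          mul_nonneg (neg_nonneg.2 hu) (sub_nonneg.2 hdisc.le)
      _ = B (B u e • u - B u u • e) (B u e • u - B u u • e) := by
          simp only [map_sub, map_smul, LinearMap.sub_apply, LinearMap.smul_apply, smul_eq_mul,
            hB.eq e u]
          ring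
  · simpa [hB.eq e u, sq] using hdisc
  · simp [mul_comm]

end BilinForm

section Vectors

variable {n : ℕ} {V : Type*} [TopologicalSpace V]
  [ChartedSpace (EuclideanSpace ℝ (Fin n)) V] [IsManifold (𝓡 n) ∞ V] {g : Spacetime n V}

theorem isLorentzian_metric (g : Spacetime n V) (x : V) :
    IsLorentzian (g.metric x).toBilinForm :=
  ⟨⟨g.symm x⟩, g.lorentzian x⟩

theorem IsFutureTimelike.isFuture {x : V} {v : TangentSpace (𝓡 n) x}
    (hv : g.IsFutureTimelike v) : g.IsFuture v :=
  ⟨hv.1.le, hv.2⟩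

theorem isFutureTimelike_timeField (g : Spacetime n V) (x : V) :
    g.IsFutureTimelike (g.timeField x) :=
  ⟨g.timelike_timeField x, g.timelike_timeField x⟩

theorem IsFuture.ne_zero {x : V} {v : TangentSpace (𝓡 n) x} (hv : g.IsFuture v) : v ≠ 0 := by
  rintro rfl
  simpa using hv.2

theorem exists_isGradientAt (g : Spacetime n V) (f : V → ℝ) (x : V) :
    ∃ v, g.IsGradientAt f x v := by
  have : FiniteDimensional ℝ (TangentSpace (𝓡 n) x) :=
    inferInstanceAs (FiniteDimensional ℝ (EuclideanSpace ℝ (Fin n)))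
  have hg := (g.isLorentzian_metric x).nondegenerate
  exact ⟨(LinearMap.BilinForm.toDual _ hg).symm (mfderiv (𝓡 n) 𝓘(ℝ, ℝ) f x).toLinearMap,
    fun _ ↦ LinearMap.BilinForm.apply_toDual_symm_apply (hB := hg) _ _⟩

theorem IsGradientAt.timelike_iff {f : V → ℝ} {x : V} {v : TangentSpace (𝓡 n) x}
    (hv : g.IsGradientAt f x v) :
    0 < g.metric x v v ↔ ∀ w, g.IsFuture w → mfderiv (𝓡 n) 𝓘(ℝ, ℝ) f x w ≠ 0 := by
  refine ⟨fun hvv w hw ↦ hv w ▸ (g.isLorentzian_metric x).apply_ne_zero hvv hw.1 hw.ne_zero,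
    fun hf ↦ ?_⟩
  by_contra! hvv
  obtain ⟨w, hww, hξw, hvw⟩ := exists_nonneg_orthogonal (g.isLorentzian_metric x).isSymm
    (g.timelike_timeField x) hvv
  exact hf w ⟨hww, hξw⟩ ((hv w).symm.trans hvw)

theorem causallyStable_iff : g.CausallyStable ↔ ∃ f : V → ℝ, ContMDiff (𝓡 n) 𝓘(ℝ, ℝ) ∞ f ∧
    ∀ (x : V) (v : TangentSpace (𝓡 n) x), g.IsFuture v → mfderiv (𝓡 n) 𝓘(ℝ, ℝ) f x v ≠ 0 := by
  refine exists_congr fun f ↦ and_congr_right fun _ ↦ forall_congr' fun x ↦ ⟨?_, fun hf ↦ ?_⟩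
  · rintro ⟨v, hv, hvv⟩
    exact hv.timelike_iff.1 hvv
  · obtain ⟨v, hv⟩ := g.exists_isGradientAt f x
    exact ⟨v, hv, hv.timelike_iff.2 hf⟩

theorem isOpen_setOf_isFutureTimelike (g : Spacetime n V) :
    IsOpen {p : TangentBundle (𝓡 n) V | g.IsFutureTimelike p.2} := by
  let F := EuclideanSpace ℝ (Fin n)
  have hπ : Continuous (TotalSpace.proj : TangentBundle (𝓡 n) V → V) :=
    FiberBundle.continuous_proj F _
  have hmetric := g.contMDiff_metric.continuous.comp hπ
  have happly {u v : ∀ p : TangentBundle (𝓡 n) V, TangentSpace (𝓡 n) p.1}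
      (hu : Continuous fun p ↦ TotalSpace.mk' F p.1 (u p))
      (hv : Continuous fun p ↦ TotalSpace.mk' F p.1 (v p)) :
      Continuous fun p ↦ g.metric p.1 (u p) (v p) :=
    continuous_snd.comp <| (Bundle.Trivial.homeomorphProd V ℝ).continuous.comp <|
      Continuous.clm_bundle_apply₂ (F₃ := ℝ) (E₃ := Bundle.Trivial V ℝ) hmetric hu hv
  exact (isOpen_lt continuous_const (happly continuous_id continuous_id)).inter
    (isOpen_lt continuous_const (happly (g.continuous_timeField.comp hπ) continuous_id))

/-- The same metric with the opposite time orientation. -/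
def reverse (g : Spacetime n V) : Spacetime n V where
  __ := g
  timeField x := -g.timeField x
  timelike_timeField x := by simpa using g.timelike_timeField x
  continuous_timeField := by
    have hξ := (contMDiff_zero_iff (I := 𝓡 n) (I' := (𝓡 n).tangent)).2 g.continuous_timeField
    exact (ContMDiff.neg_section hξ).continuous

theorem isFutureTimelike_reverse {x : V} {v : TangentSpace (𝓡 n) x} :
    g.reverse.IsFutureTimelike v ↔ g.IsFutureTimelike (-v) := by
  simp [IsFutureTimelike, reverse]

end Vectors

section Velocity

variable {n : ℕ} {V : Type*} [TopologicalSpace V] [ChartedSpace (EuclideanSpace ℝ (Fin n)) V]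
  {γ : ℝ → V} {a b t : ℝ}

theorem velocity_eq_of_hasDerivWithinAt {γ : ℝ → EuclideanSpace ℝ (Fin n)}
    {w : EuclideanSpace ℝ (Fin n)} (hab : a < b) (ht : t ∈ Icc a b)
    (hγ : HasDerivWithinAt γ w (Icc a b) t) : velocity n γ a b t = w := by
  rw [velocity, mfderivWithin_eq_fderivWithin]
  exact hγ.derivWithin (uniqueDiffOn_Icc hab t ht)

theorem velocity_comp_param {σ : ℝ → ℝ} {c d k : ℝ} (hcd : c < d) (ht : t ∈ Icc c d)
    (hγ : MDifferentiableWithinAt 𝓘(ℝ, ℝ) (𝓡 n) γ (Icc a b) (σ t))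
    (hσ : HasDerivAt σ k t) (hmaps : MapsTo σ (Icc c d) (Icc a b)) :
    velocity n (γ ∘ σ) c d t = k • velocity n γ a b (σ t) := by
  have hu := uniqueDiffOn_Icc hcd t ht
  have hσk : mfderivWithin 𝓘(ℝ, ℝ) 𝓘(ℝ, ℝ) σ (Icc c d) t (1 : ℝ) = k • (1 : ℝ) := by
    rw [mfderivWithin_eq_fderivWithin, smul_eq_mul, mul_one]
    exact hσ.hasDerivWithinAt.derivWithin hu
  rw [velocity, mfderivWithin_comp t hγ
    hσ.differentiableAt.mdifferentiableAt.mdifferentiableWithinAt hmaps hu.uniqueMDiffWithinAt]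
  exact (congrArg (mfderivWithin 𝓘(ℝ, ℝ) (𝓡 n) γ (Icc a b) (σ t)) hσk).trans
    ((mfderivWithin 𝓘(ℝ, ℝ) (𝓡 n) γ (Icc a b) (σ t)).map_smul k (1 : ℝ))

theorem velocity_comp {m : ℕ} {W : Type*} [TopologicalSpace W]
    [ChartedSpace (EuclideanSpace ℝ (Fin m)) W] {f : V → W} {u : Set V}
    (hab : a < b) (ht : t ∈ Icc a b)
    (hf : MDifferentiableWithinAt (𝓡 n) (𝓡 m) f u (γ t))
    (hγ : MDifferentiableWithinAt 𝓘(ℝ, ℝ) (𝓡 n) γ (Icc a b) t)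
    (hu : γ ⁻¹' u ∈ 𝓝[Icc a b] t) :
    velocity m (f ∘ γ) a b t =
      mfderivWithin (𝓡 n) (𝓡 m) f u (γ t) (velocity n γ a b t) := by
  rw [velocity, mfderivWithin_comp_of_preimage_mem_nhdsWithin t hf hγ hu
    (uniqueDiffOn_Icc hab t ht).uniqueMDiffWithinAt]
  rfl

theorem velocity_map {m : ℕ} {W : Type*} [TopologicalSpace W]
    [ChartedSpace (EuclideanSpace ℝ (Fin m)) W] {Φ : V → W} (hab : a < b) (ht : t ∈ Icc a b)
    (hΦ : ContMDiff (𝓡 n) (𝓡 m) 1 Φ) (hγ : ContMDiffOn 𝓘(ℝ, ℝ) (𝓡 n) 1 γ (Icc a b)) :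
    velocity m (Φ ∘ γ) a b t = mfderiv (𝓡 n) (𝓡 m) Φ (γ t) (velocity n γ a b t) := by
  rw [velocity_comp (u := univ) hab ht (hΦ.mdifferentiable one_ne_zero _).mdifferentiableWithinAt
    (hγ.mdifferentiableOn one_ne_zero t ht) Filter.univ_mem, mfderivWithin_univ]

end Velocity

section Chronology

variable {n : ℕ} {V : Type*} [TopologicalSpace V]
  [ChartedSpace (EuclideanSpace ℝ (Fin n)) V] [IsManifold (𝓡 n) ∞ V] {g : Spacetime n V}
  {γ γ' : ℝ → V} {a b c d : ℝ} {U U' : Set V} {p q r : V}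

theorem IsTimelikeArc.congr (hγ : g.IsTimelikeArc γ a b) (heq : EqOn γ' γ (Icc a b)) :
    g.IsTimelikeArc γ' a b := by
  refine ⟨hγ.1, hγ.2.1.congr heq, fun t ht ↦ ?_⟩
  change g.IsFutureTimelike (tangentMapWithin 𝓘(ℝ, ℝ) (𝓡 n) γ' (Icc a b) ⟨t, (1 : ℝ)⟩).2
  rw [tangentMapWithin_congr heq _ ht]
  exact hγ.2.2 t ht

theorem IsTimelikeArc.mono (hγ : g.IsTimelikeArc γ a b) (hac : a ≤ c) (hcd : c < d)
    (hdb : d ≤ b) : g.IsTimelikeArc γ c d := by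
  have hsub : Icc c d ⊆ Icc a b := Icc_subset_Icc hac hdb
  refine ⟨hcd, hγ.2.1.mono hsub, fun t ht ↦ ?_⟩
  rw [velocity, mfderivWithin_subset hsub ((uniqueDiffOn_Icc hcd).uniqueMDiffOn t ht)
    (hγ.2.1.mdifferentiableOn one_ne_zero t (hsub ht))]
  exact hγ.2.2 t (hsub ht)

theorem IsTimelikeArc.comp_add_const (hγ : g.IsTimelikeArc γ a b) (s : ℝ) :
    g.IsTimelikeArc (γ ∘ (· + s)) (a - s) (b - s) := by
  have hmaps : MapsTo (· + s) (Icc (a - s) (b - s)) (Icc a b) :=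
    fun t ht ↦ ⟨sub_le_iff_le_add.1 ht.1, le_sub_iff_add_le.1 ht.2⟩
  have hlt : a - s < b - s := sub_lt_sub_right hγ.1 s
  refine ⟨hlt, hγ.2.1.comp (contDiff_id.add contDiff_const).contMDiff.contMDiffOn hmaps,
    fun t ht ↦ ?_⟩
  rw [velocity_comp_param hlt ht (hγ.2.1.mdifferentiableOn one_ne_zero _ (hmaps ht))
    ((hasDerivAt_id' t).add_const s) hmaps, one_smul]
  exact hγ.2.2 _ (hmaps ht)

theorem IsTimelikeArc.reverse (hγ : g.IsTimelikeArc γ a b) :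
    g.reverse.IsTimelikeArc (γ ∘ Neg.neg) (-b) (-a) := by
  have hmaps : MapsTo Neg.neg (Icc (-b) (-a)) (Icc a b) :=
    fun t ht ↦ ⟨le_neg.1 ht.2, neg_le.1 ht.1⟩
  have hlt : -b < -a := neg_lt_neg hγ.1
  refine ⟨hlt, hγ.2.1.comp contDiff_neg.contMDiff.contMDiffOn hmaps, fun t ht ↦ ?_⟩
  rw [velocity_comp_param hlt ht (hγ.2.1.mdifferentiableOn one_ne_zero _ (hmaps ht))
    (hasDerivAt_neg t) hmaps, isFutureTimelike_reverse, neg_one_smul, neg_neg]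
  exact hγ.2.2 _ (hmaps ht)

/-- `p` is joined to `q` by a single future-directed timelike `C^1` arc contained in `U`; the
relation `ChronIn U` is its transitive closure. -/
def ArcJoinedIn (g : Spacetime n V) (U : Set V) (p q : V) : Prop :=
  ∃ (γ : ℝ → V) (a b : ℝ), g.IsTimelikeArc γ a b ∧ γ a = p ∧ γ b = q ∧ MapsTo γ (Icc a b) U

theorem ArcJoinedIn.reverse (hpq : g.ArcJoinedIn U p q) : g.reverse.ArcJoinedIn U q p := by
  obtain ⟨γ, a, b, hγ, rfl, rfl, hU⟩ := hpq
  exact ⟨γ ∘ Neg.neg, -b, -a, hγ.reverse, by simp, by simp,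
    hU.comp fun t ht ↦ ⟨le_neg.1 ht.2, neg_le.1 ht.1⟩⟩

theorem reverse_reverse (g : Spacetime n V) : g.reverse.reverse = g := by
  simp [Spacetime.reverse]

theorem arcJoinedIn_reverse : g.reverse.ArcJoinedIn U = Function.swap (g.ArcJoinedIn U) :=
  funext₂ fun _ _ ↦ propext
    ⟨fun hpq ↦ g.reverse_reverse ▸ hpq.reverse, ArcJoinedIn.reverse⟩

theorem ArcJoinedIn.exists_arc_from (hpq : g.ArcJoinedIn U p q) (s : ℝ) :
    ∃ (γ : ℝ → V) (d : ℝ), g.IsTimelikeArc γ s d ∧ γ s = p ∧ γ d = q ∧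
      MapsTo γ (Icc s d) U := by
  obtain ⟨γ, a, b, hγ, rfl, rfl, hU⟩ := hpq
  refine ⟨γ ∘ (· + (a - s)), b - (a - s), ?_, by simp, by simp, hU.comp fun t ht ↦ ?_⟩
  · simpa only [sub_sub_cancel] using hγ.comp_add_const (a - s)
  · constructor <;> linarith [ht.1, ht.2]

theorem IsTimelikeCurve.exists_partition (hγ : g.IsTimelikeCurve γ a b) :
    ∃ (k : ℕ) (τ : ℕ → ℝ), τ 0 = a ∧ τ k = b ∧
      ∀ i < k, g.IsTimelikeArc γ (τ i) (τ (i + 1)) ∧ Icc (τ i) (τ (i + 1)) ⊆ Icc a b := by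
  obtain ⟨-, k, τ, rfl, rfl, hτ⟩ := hγ
  have hmono : MonotoneOn τ (Iic k) :=
    monotoneOn_of_le_succ ordConnected_Iic fun i _ _ hi ↦ (hτ i (Nat.lt_of_succ_le hi)).1.le
  exact ⟨k, τ, rfl, rfl, fun i hi ↦ ⟨hτ i hi, Icc_subset_Icc
    (hmono (Nat.zero_le k) hi.le (Nat.zero_le i)) (hmono hi self_mem_Iic hi)⟩⟩

theorem IsTimelikeCurve.congr (hγ : g.IsTimelikeCurve γ a b) (heq : EqOn γ' γ (Icc a b)) :
    g.IsTimelikeCurve γ' a b := by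
  obtain ⟨k, τ, h0, hk, hτ⟩ := hγ.exists_partition
  exact ⟨hγ.1, k, τ, h0, hk, fun i hi ↦ (hτ i hi).1.congr (heq.mono (hτ i hi).2)⟩

theorem IsTimelikeArc.isTimelikeCurve (hγ : g.IsTimelikeArc γ a b) : g.IsTimelikeCurve γ a b :=
  ⟨hγ.1, 1, fun i ↦ if i = 0 then a else b, by simp, by simp, fun i hi ↦ by
    simpa [Nat.lt_one_iff.1 hi] using hγ⟩

theorem IsTimelikeCurve.extend (hγ : g.IsTimelikeCurve γ a b) (hγ' : g.IsTimelikeArc γ b c) :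
    g.IsTimelikeCurve γ a c := by
  obtain ⟨hab, k, τ, rfl, rfl, hτ⟩ := hγ
  refine ⟨hab.trans hγ'.1, k + 1, Function.update τ (k + 1) c, by simp, by simp, fun i hi ↦ ?_⟩
  rcases Nat.lt_succ_iff_lt_or_eq.1 hi with hik | rfl
  · simpa [Function.update_of_ne, hi.ne, hik.ne] using hτ i hik
  · simpa using hγ'

theorem ChronIn.mono (hpq : g.ChronIn U p q) (hUU' : U ⊆ U') : g.ChronIn U' p q := by
  obtain ⟨γ, a, b, hγ, ha, hb, hU⟩ := hpq
  exact ⟨γ, a, b, hγ, ha, hb, hU.mono_right hUU'⟩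

theorem ChronIn.right_mem (hpq : g.ChronIn U p q) : q ∈ U := by
  obtain ⟨γ, a, b, hγ, -, rfl, hU⟩ := hpq
  exact hU (right_mem_Icc.2 hγ.1.le)

theorem ChronIn.tail (hpq : g.ChronIn U p q) (hqr : g.ArcJoinedIn U q r) : g.ChronIn U p r := by
  obtain ⟨γ, a, b, hγ, rfl, rfl, hγU⟩ := hpq
  obtain ⟨c, d, hc, hcb, rfl, hcU⟩ := hqr.exists_arc_from b
  classical
  let γc := (Iic b).piecewise γ c
  have hleft : EqOn γc γ (Icc a b) := (piecewise_eqOn _ _ _).mono fun t ht ↦ ht.2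
  have hright : EqOn γc c (Icc b d) := fun t ht ↦ by
    rcases ht.1.eq_or_lt with rfl | hbt
    · rw [hcb]
      exact piecewise_eq_of_mem _ _ _ self_mem_Iic
    · exact piecewise_eq_of_notMem _ _ _ (notMem_Iic.2 hbt)
  refine ⟨γc, a, d, (hγ.congr hleft).extend (hc.congr hright), hleft (left_mem_Icc.2 hγ.1.le),
    hright (right_mem_Icc.2 hc.1.le), ?_⟩
  rw [← Icc_union_Icc_eq_Icc hγ.1.le hc.1.le]
  exact (hγU.congr hleft.symm).union (hcU.congr hright.symm)

theorem chronIn_iff_transGen : g.ChronIn U p q ↔ Relation.TransGen (g.ArcJoinedIn U) p q := by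
  constructor
  · rintro ⟨γ, a, b, hγ, rfl, rfl, hU⟩
    obtain ⟨k, τ, rfl, rfl, hτ⟩ := hγ.exists_partition
    have hk : 0 < k := Nat.pos_of_ne_zero fun hk ↦ (hk ▸ hγ.1).false
    refine (transGen_of_succ_of_lt (fun i j ↦ g.ArcJoinedIn U (γ (τ i)) (γ (τ j)))
      (fun i hi ↦ ?_) hk).lift (γ ∘ τ) fun _ _ hij ↦ hij
    exact ⟨γ, _, _, (hτ i hi.2).1, rfl, rfl, hU.mono_left (hτ i hi.2).2⟩
  · intro hpq
    induction hpq with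
    | single hpq =>
      obtain ⟨γ, a, b, hγ, hU⟩ := hpq
      exact ⟨γ, a, b, hγ.isTimelikeCurve, hU⟩
    | tail _ hqr ih => exact ih.tail hqr

theorem ChronIn.trans (hpq : g.ChronIn U p q) (hqr : g.ChronIn U q r) : g.ChronIn U p r :=
  chronIn_iff_transGen.2 ((chronIn_iff_transGen.1 hpq).trans (chronIn_iff_transGen.1 hqr))

theorem chronIn_reverse : g.reverse.ChronIn U p q ↔ g.ChronIn U q p := by
  rw [chronIn_iff_transGen, chronIn_iff_transGen, arcJoinedIn_reverse, Relation.transGen_swap]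

theorem chronFuture_reverse (p : V) : g.reverse.chronFuture p = g.chronPast p :=
  ext fun _ ↦ chronIn_reverse

theorem futureDistinguishing_reverse :
    g.reverse.FutureDistinguishing ↔ g.PastDistinguishing := by
  simp only [FutureDistinguishing, PastDistinguishing, chronFuture_reverse]

end Chronology

section Openness

variable {n : ℕ} {V : Type*} [TopologicalSpace V]
  [ChartedSpace (EuclideanSpace ℝ (Fin n)) V] [IsManifold (𝓡 n) ∞ V] {g : Spacetime n V}

/-- The coordinate vector of `v` in the preferred chart at its base point. -/
def chartVector {x : V} (v : TangentSpace (𝓡 n) x) : EuclideanSpace ℝ (Fin n) :=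
  mfderiv (𝓡 n) (𝓡 n) (extChartAt (𝓡 n) x) x v

theorem tangentMapWithin_extChartAt_symm (x : V) (v : TangentSpace (𝓡 n) x) :
    tangentMapWithin (𝓡 n) (𝓡 n) (extChartAt (𝓡 n) x).symm (extChartAt (𝓡 n) x).target
      ⟨extChartAt (𝓡 n) x x, chartVector v⟩ =
      (⟨x, v⟩ : TangentBundle (𝓡 n) V) := by
  have hx := mem_extChartAt_source (I := 𝓡 n) x
  have hz := mem_extChartAt_target (I := 𝓡 n) x
  refine TotalSpace.ext ((extChartAt (𝓡 n) x).left_inv hx) (heq_of_eq ?_)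
  rw [tangentMapWithin, mfderivWithin_subset (extChartAt_target_subset_range x)
    ((isOpen_extChartAt_target x).uniqueMDiffOn _ hz) (mdifferentiableWithinAt_extChartAt_symm hz)]
  exact DFunLike.congr_fun (mfderivWithin_extChartAt_symm_comp_mfderiv_extChartAt' hx) v

theorem eventually_isFutureTimelike_extChartAt_symm {x : V} {v : TangentSpace (𝓡 n) x}
    (hv : g.IsFutureTimelike v) :
    ∀ᶠ p : EuclideanSpace ℝ (Fin n) × EuclideanSpace ℝ (Fin n) in
      𝓝 (extChartAt (𝓡 n) x x, chartVector v),
      g.IsFutureTimelike (mfderivWithin (𝓡 n) (𝓡 n)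
        (extChartAt (𝓡 n) x).symm (extChartAt (𝓡 n) x).target p.1 p.2) := by
  have hopen := isOpen_extChartAt_target (I := 𝓡 n) x
  have hcont := (contMDiffOn_extChartAt_symm (I := 𝓡 n) (n := 1) x).continuousOn_tangentMapWithin
    le_rfl hopen.uniqueMDiffOn
  have hat := hcont.continuousAt ((hopen.preimage (FiberBundle.continuous_proj _ _)).mem_nhds
    (x := ⟨_, chartVector v⟩) (mem_extChartAt_target x))
  have hnhds := g.isOpen_setOf_isFutureTimelike.mem_nhds (x := ⟨x, v⟩) hv
  rw [← tangentMapWithin_extChartAt_symm] at hnhds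
  exact (hat.comp (f := fun p ↦ (⟨p.1, p.2⟩ : TangentBundle (𝓡 n) _))
    (x := (extChartAt (𝓡 n) x x, chartVector v))
    (tangentBundleModelSpaceHomeomorph (𝓡 n)).symm.continuous.continuousAt).eventually hnhds

theorem exists_nhds_arcJoinedIn_extChartAt_symm {x : V} {v : TangentSpace (𝓡 n) x}
    (hv : g.IsFutureTimelike v) {N : Set V} (hN : N ∈ 𝓝 x) :
    ∃ U ∈ 𝓝 (extChartAt (𝓡 n) x x), ∃ C ∈ 𝓝 (chartVector v),
      ∀ z ∈ U, ∀ w ∈ C, ∀ δ > (0 : ℝ), z + δ • w ∈ U →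
        g.ArcJoinedIn N ((extChartAt (𝓡 n) x).symm z) ((extChartAt (𝓡 n) x).symm (z + δ • w)) := by
  have hcone := eventually_isFutureTimelike_extChartAt_symm hv
  rw [nhds_prod_eq, Filter.eventually_prod_iff] at hcone
  obtain ⟨P, hP, Q, hQ, hPQ⟩ := hcone
  have hN' := (continuousAt_extChartAt_symm (I := 𝓡 n) x).preimage_mem_nhds
    ((extChartAt_to_inv (I := 𝓡 n) x).symm ▸ hN)
  obtain ⟨r, hr, hball⟩ := Metric.mem_nhds_iff.1
    (Filter.inter_mem (Filter.inter_mem (extChartAt_target_mem_nhds x) hN') hP)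
  refine ⟨_, Metric.ball_mem_nhds _ hr, _, hQ, fun z hz w hw δ hδ hzw ↦ ?_⟩
  have hseg : ∀ t ∈ Icc 0 δ, z + t • w ∈ Metric.ball (extChartAt (𝓡 n) x x) r := fun t ht ↦ by
    have := (convex_ball (extChartAt (𝓡 n) x x) r).add_smul_mem hz hzw
      (t := t / δ) ⟨div_nonneg ht.1 hδ.le, (div_le_one hδ).2 ht.2⟩
    rwa [smul_smul, div_mul_cancel₀ _ hδ.ne'] at this
  have hmaps : MapsTo (fun t : ℝ ↦ z + t • w) (Icc 0 δ) (extChartAt (𝓡 n) x).target :=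
    fun t ht ↦ (hball (hseg t ht)).1.1
  have hline : ContDiff ℝ 1 (fun t : ℝ ↦ z + t • w) := by fun_prop
  have hsymm := contMDiffOn_extChartAt_symm (I := 𝓡 n) (n := 1) x
  refine ⟨(extChartAt (𝓡 n) x).symm ∘ fun t : ℝ ↦ z + t • w, 0, δ, ⟨hδ,
    hsymm.comp hline.contMDiff.contMDiffOn hmaps, fun t ht ↦ ?_⟩, by simp, rfl,
    fun t ht ↦ (hball (hseg t ht)).1.2⟩
  have hderiv : HasDerivAt (fun t : ℝ ↦ z + t • w) w t := by
    simpa using ((hasDerivAt_id t).smul_const w).const_add z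
  rw [velocity_comp hδ ht (hsymm.mdifferentiableOn one_ne_zero _ (hmaps ht))
    hderiv.differentiableAt.mdifferentiableAt.mdifferentiableWithinAt
    (Filter.mem_of_superset self_mem_nhdsWithin hmaps),
    velocity_eq_of_hasDerivWithinAt hδ ht hderiv.hasDerivWithinAt]
  exact hPQ (hball (hseg t ht)).2 hw

theorem exists_chronIn (g : Spacetime n V) {x : V} {U : Set V} (hU : U ∈ 𝓝 x) :
    ∃ y, g.ChronIn U x y := by
  obtain ⟨A, hA, C, hC, H⟩ :=
    exists_nhds_arcJoinedIn_extChartAt_symm (g.isFutureTimelike_timeField x) hU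
  set w := chartVector (g.timeField x)
  have hlim : Filter.Tendsto (fun δ : ℝ ↦ extChartAt (𝓡 n) x x + δ • w) (𝓝[>] 0)
      (𝓝 (extChartAt (𝓡 n) x x)) := by
    have : ContinuousAt (fun δ : ℝ ↦ extChartAt (𝓡 n) x x + δ • w) 0 := by fun_prop
    simpa using this.tendsto.mono_left nhdsWithin_le_nhds
  obtain ⟨δ, hδ, hmem⟩ := (eventually_mem_nhdsWithin.and (hlim.eventually hA)).exists
  have harc := H _ (mem_of_mem_nhds hA) w (mem_of_mem_nhds hC) δ hδ hmem
  rw [extChartAt_to_inv] at harc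
  exact ⟨_, chronIn_iff_transGen.2 (.single harc)⟩

theorem IsTimelikeArc.hasDerivWithinAt_extChartAt {γ : ℝ → V} {a b t : ℝ}
    (hγ : g.IsTimelikeArc γ a b) (ht : t ∈ Icc a b) :
    HasDerivWithinAt (extChartAt (𝓡 n) (γ t) ∘ γ)
      (chartVector (velocity n γ a b t)) (Icc a b) t := by
  have hγt := hγ.2.1.mdifferentiableOn one_ne_zero t ht
  have hφ := mdifferentiableAt_extChartAt (I := 𝓡 n) (mem_chart_source _ (γ t))
  have hderiv := (hφ.comp_mdifferentiableWithinAt t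
    hγt).differentiableWithinAt.hasDerivWithinAt
  rw [← velocity_eq_of_hasDerivWithinAt hγ.1 ht hderiv, velocity_comp (u := univ) hγ.1 ht
    hφ.mdifferentiableWithinAt hγt Filter.univ_mem, mfderivWithin_univ] at hderiv
  exact hderiv

/-- The chord of the arc from `p` to a later point near `p` has, in coordinates, almost the initial
direction of the arc, so the segments from points near `p` to the same end are timelike as well. -/
theorem ArcJoinedIn.eventually_chronIn {U : Set V} {p q : V} (hpq : g.ArcJoinedIn U p q)
    (hU : U ∈ 𝓝 p) : ∀ᶠ p' in 𝓝 p, g.ChronIn U p' q := by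
  obtain ⟨γ, a, b, hγ, rfl, rfl, hγU⟩ := hpq
  have ha := left_mem_Icc.2 hγ.1.le
  obtain ⟨A, hA, C, hC, H⟩ := exists_nhds_arcJoinedIn_extChartAt_symm (hγ.2.2 a ha) hU
  have hderiv := (hγ.hasDerivWithinAt_extChartAt ha).mono Ioo_subset_Icc_self
  set φ := extChartAt (𝓡 n) (γ a)
  have hγa := (hγ.2.1.continuousOn a ha).mono Ioo_subset_Icc_self
  have := left_nhdsWithin_Ioo_neBot hγ.1
  obtain ⟨s, hs, hslope, hsA, hsφ⟩ := (eventually_mem_nhdsWithin.and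
    ((((hasDerivWithinAt_iff_tendsto_slope' (by simp)).1 hderiv).eventually
      (eventually_mem_nhds_iff.2 hC)).and ((hderiv.continuousWithinAt.eventually hA).and
        (hγa.eventually (extChartAt_source_mem_nhds (I := 𝓡 n) (γ a)))))).exists
  have hφ : ContinuousAt φ (γ a) := continuousAt_extChartAt (γ a)
  have hdir : ContinuousAt (fun p' ↦ (s - a)⁻¹ • (φ (γ s) - φ p')) (γ a) := by fun_prop
  filter_upwards [extChartAt_source_mem_nhds (I := 𝓡 n) (γ a), hφ.eventually hA,
    hdir.eventually hslope] with p' hp'φ hp'A hp'C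
  have hend : φ p' + (s - a) • ((s - a)⁻¹ • (φ (γ s) - φ p')) = φ (γ s) := by
    rw [smul_inv_smul₀ (sub_pos.2 hs.1).ne', add_sub_cancel]
  have harc := H (φ p') hp'A _ hp'C (s - a) (sub_pos.2 hs.1) (by rwa [hend])
  rw [hend, φ.left_inv hp'φ, φ.left_inv hsφ] at harc
  exact chronIn_iff_transGen.2 <| .head harc <| .single
    ⟨γ, s, b, hγ.mono hs.1.le hs.2 le_rfl, rfl, rfl, hγU.mono_left (Icc_subset_Icc_left hs.1.le)⟩

theorem ChronIn.eventually_left {U : Set V} {p q : V} (hpq : g.ChronIn U p q) (hU : U ∈ 𝓝 p) :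
    ∀ᶠ p' in 𝓝 p, g.ChronIn U p' q := by
  obtain ⟨r, hpr, hrq⟩ := Relation.TransGen.head'_iff.1 (chronIn_iff_transGen.1 hpq)
  filter_upwards [hpr.eventually_chronIn hU] with p' hp'r
  exact chronIn_iff_transGen.2 ((chronIn_iff_transGen.1 hp'r).trans_left hrq)

end Openness

theorem IsPastEndpoint.map {X Y : Type*} [TopologicalSpace X] [TopologicalSpace Y] {f : X → Y}
    {γ : ℝ → X} {s : Set ℝ} {x : X} (hx : IsPastEndpoint γ s x) (hf : ContinuousAt f x) :
    IsPastEndpoint (f ∘ γ) s (f x) :=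
  fun _ hU ↦ hx _ (hf.preimage_mem_nhds hU)

theorem IsFutureEndpoint.map {X Y : Type*} [TopologicalSpace X] [TopologicalSpace Y] {f : X → Y}
    {γ : ℝ → X} {s : Set ℝ} {x : X} (hx : IsFutureEndpoint γ s x) (hf : ContinuousAt f x) :
    IsFutureEndpoint (f ∘ γ) s (f x) :=
  fun _ hU ↦ hx _ (hf.preimage_mem_nhds hU)

theorem IsHypersurface.preimage_homeomorph {n : ℕ} {X Y : Type*} [TopologicalSpace X]
    [TopologicalSpace Y] {S : Set Y} (hS : IsHypersurface n S) (Φ : X ≃ₜ Y) :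
    IsHypersurface n (Φ ⁻¹' S) := by
  intro x hx
  obtain ⟨e, H, hxe, hH, heS⟩ := hS (Φ x) hx
  refine ⟨Φ.transOpenPartialHomeomorph e, H, hxe, hH, Eq.trans ?_ heS⟩
  change (e ∘ Φ) '' (Φ ⁻¹' e.source ∩ Φ ⁻¹' S) = e '' (e.source ∩ S)
  rw [← preimage_inter, image_comp, image_preimage_eq _ Φ.surjective]

section CausalMap

variable {m n : ℕ}
  {V : Type*} [TopologicalSpace V] [ChartedSpace (EuclideanSpace ℝ (Fin m)) V]
  [IsManifold (𝓡 m) ∞ V]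
  {W : Type*} [TopologicalSpace W] [ChartedSpace (EuclideanSpace ℝ (Fin n)) W]
  [IsManifold (𝓡 n) ∞ W] {g : Spacetime m V} {h : Spacetime n W} {Φ : V → W}

/-- A `C^1` map whose differential maps future-directed vectors to future-directed vectors. -/
structure IsCausalMap (g : Spacetime m V) (h : Spacetime n W) (Φ : V → W) : Prop where
  contMDiff : ContMDiff (𝓡 m) (𝓡 n) 1 Φ
  isFuture_mfderiv : ∀ {x : V} {v : TangentSpace (𝓡 m) x}, g.IsFuture v →
    h.IsFuture (mfderiv (𝓡 m) (𝓡 n) Φ x v)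

/-- A `C^1` map whose differential maps future-directed timelike vectors to future-directed timelike
vectors. -/
structure IsTimelikeMap (g : Spacetime m V) (h : Spacetime n W) (Φ : V → W) : Prop where
  contMDiff : ContMDiff (𝓡 m) (𝓡 n) 1 Φ
  isFutureTimelike_mfderiv : ∀ {x : V} {v : TangentSpace (𝓡 m) x}, g.IsFutureTimelike v →
    h.IsFutureTimelike (mfderiv (𝓡 m) (𝓡 n) Φ x v)

theorem IsFutureTimelike.eventually_sub_smul {x : V} {v : TangentSpace (𝓡 m) x}
    (hv : g.IsFutureTimelike v) (w : TangentSpace (𝓡 m) x) :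
    ∀ᶠ s in 𝓝 (0 : ℝ), g.IsFutureTimelike (v - s • w) := by
  have hline : Continuous fun s : ℝ ↦ v - s • w := by fun_prop
  have hfiber := FiberBundle.continuous_totalSpaceMk (EuclideanSpace ℝ (Fin m))
    (TangentSpace (𝓡 m) : V → Type) x
  exact (hfiber.comp hline).continuousAt.eventually
    (g.isOpen_setOf_isFutureTimelike.mem_nhds (by simpa using hv))

theorem IsFuture.isFutureTimelike_of_sub_smul {x : V} {v : TangentSpace (𝓡 m) x} {s : ℝ}
    (hv : g.IsFuture v) (hs : 0 < s) (hvs : g.IsFuture (v - s • g.timeField x)) :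
    g.IsFutureTimelike v := by
  refine ⟨?_, hv.2⟩
  obtain ⟨hnorm, htime⟩ := hvs
  simp only [map_sub, map_smul, smul_eq_mul, sub_apply,
    smul_apply, g.symm x v (g.timeField x)] at hnorm htime
  nlinarith [hv.2]

theorem IsCausalMap.isTimelikeMap (hΦ : g.IsCausalMap h Φ)
    (hsurj : ∀ x, Function.Surjective (mfderiv (𝓡 m) (𝓡 n) Φ x)) : g.IsTimelikeMap h Φ := by
  refine ⟨hΦ.contMDiff, fun {x v} hv ↦ ?_⟩
  obtain ⟨w, hw⟩ := hsurj x (h.timeField (Φ x))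
  obtain ⟨s, hvs, hs⟩ := ((hv.eventually_sub_smul w).filter_mono nhdsWithin_le_nhds |>.and
    (eventually_mem_nhdsWithin (s := Ioi 0))).exists
  refine (hΦ.isFuture_mfderiv hv.isFuture).isFutureTimelike_of_sub_smul hs ?_
  rw [← hw, ← map_smul, ← map_sub]
  exact hΦ.isFuture_mfderiv hvs.isFuture

namespace IsTimelikeMap

theorem isTimelikeArc (hΦ : g.IsTimelikeMap h Φ) {γ : ℝ → V} {a b : ℝ}
    (hγ : g.IsTimelikeArc γ a b) : h.IsTimelikeArc (Φ ∘ γ) a b := by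
  refine ⟨hγ.1, hΦ.contMDiff.comp_contMDiffOn hγ.2.1, fun t ht ↦ ?_⟩
  rw [velocity_map hγ.1 ht hΦ.contMDiff hγ.2.1]
  exact hΦ.isFutureTimelike_mfderiv (hγ.2.2 t ht)

theorem chronIn (hΦ : g.IsTimelikeMap h Φ) {U : Set V} {U' : Set W} (hU : MapsTo Φ U U')
    {p q : V} (hpq : g.ChronIn U p q) : h.ChronIn U' (Φ p) (Φ q) := by
  obtain ⟨γ, a, b, ⟨hab, k, τ, h0, hk, hτ⟩, rfl, rfl, hγU⟩ := hpq
  exact ⟨Φ ∘ γ, a, b, ⟨hab, k, τ, h0, hk, fun i hi ↦ hΦ.isTimelikeArc (hτ i hi)⟩, rfl, rfl,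
    hU.comp hγU⟩

theorem reverse (hΦ : g.IsTimelikeMap h Φ) : g.reverse.IsTimelikeMap h.reverse Φ :=
  ⟨hΦ.contMDiff, fun {x v} hv ↦ isFutureTimelike_reverse.2 <| by
    rw [← map_neg]
    exact hΦ.isFutureTimelike_mfderiv (isFutureTimelike_reverse.1 hv)⟩

theorem notTotallyVicious (hΦ : g.IsTimelikeMap h Φ) (hsurj : Function.Surjective Φ)
    (hh : h.NotTotallyVicious) : g.NotTotallyVicious := by
  refine fun x hx ↦ hh (Φ x) (eq_univ_of_forall (hsurj.forall.2 fun y ↦ ?_))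
  obtain ⟨hxy, hyx⟩ : y ∈ g.chronFuture x ∩ g.chronPast x := hx ▸ mem_univ y
  exact ⟨hΦ.chronIn (mapsTo_univ _ _) hxy, hΦ.chronIn (mapsTo_univ _ _) hyx⟩

theorem chronological (hΦ : g.IsTimelikeMap h Φ) (hh : h.Chronological) : g.Chronological :=
  fun x hx ↦ hh (Φ x) (hΦ.chronIn (mapsTo_univ _ _) hx)

theorem chronFuture_subset (hΦ : g.IsTimelikeMap h Φ) {x y : V}
    (hxy : g.chronFuture x ⊆ g.chronFuture y) : h.chronFuture (Φ x) ⊆ h.chronFuture (Φ y) := by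
  intro z hz
  obtain ⟨x', hx'⟩ := g.exists_chronIn (hΦ.contMDiff.continuous.continuousAt.preimage_mem_nhds
    (ChronIn.eventually_left hz Filter.univ_mem))
  exact (hΦ.chronIn (mapsTo_univ _ _) (hxy (hx'.mono (subset_univ _)))).trans hx'.right_mem

theorem futureDistinguishing (hΦ : g.IsTimelikeMap h Φ) (hinj : Function.Injective Φ)
    (hh : h.FutureDistinguishing) : g.FutureDistinguishing := fun _ _ hxy ↦
  hinj <| hh _ _ <| (hΦ.chronFuture_subset hxy.subset).antisymm
    (hΦ.chronFuture_subset hxy.symm.subset)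

theorem distinguishing (hΦ : g.IsTimelikeMap h Φ) (hinj : Function.Injective Φ)
    (hh : h.Distinguishing) : g.Distinguishing := by
  refine ⟨hΦ.futureDistinguishing hinj hh.1, ?_⟩
  have hpast := futureDistinguishing_reverse.2 hh.2
  exact futureDistinguishing_reverse.1 (hΦ.reverse.futureDistinguishing hinj hpast)

theorem edge_preimage_subset (hΦ : g.IsTimelikeMap h Φ) (S : Set W) :
    g.edge (Φ ⁻¹' S) ⊆ Φ ⁻¹' h.edge S := by
  rintro x ⟨hx, hedge⟩
  refine ⟨hΦ.contMDiff.continuous.closure_preimage_subset S hx, fun U hU ↦ ?_⟩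
  obtain ⟨p, q, hpx, hxq, hpq⟩ :=
    hedge (Φ ⁻¹' U) (hΦ.contMDiff.continuous.continuousAt.preimage_mem_nhds hU)
  exact ⟨Φ p, Φ q, hΦ.chronIn (mapsTo_preimage _ _) hpx, hΦ.chronIn (mapsTo_preimage _ _) hxq,
    hΦ.chronIn (mapsTo_preimage Φ (U \ S)) hpq⟩

end IsTimelikeMap

namespace IsCausalMap

theorem isCausalArc (hΦ : g.IsCausalMap h Φ) {γ : ℝ → V} {a b : ℝ}
    (hγ : g.IsCausalArc γ a b) : h.IsCausalArc (Φ ∘ γ) a b := by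
  refine ⟨hγ.1, hΦ.contMDiff.comp_contMDiffOn hγ.2.1, fun t ht ↦ ?_⟩
  rw [velocity_map hγ.1 ht hΦ.contMDiff hγ.2.1]
  exact hΦ.isFuture_mfderiv (hγ.2.2 t ht)

theorem isCausalCurve (hΦ : g.IsCausalMap h Φ) {γ : ℝ → V} {s : Set ℝ}
    (hγ : g.IsCausalCurve γ s) : h.IsCausalCurve (Φ ∘ γ) s := by
  have hcont := hΦ.contMDiff.continuous
  refine ⟨hγ.1, hcont.comp_continuousOn hγ.2.1, fun t ht U hU ↦ ?_⟩
  obtain ⟨ε, hε, hlocal⟩ := hγ.2.2 t ht (Φ ⁻¹' U) (hcont.continuousAt.preimage_mem_nhds hU)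
  refine ⟨ε, hε, fun t₁ ht₁ t₂ ht₂ h₁ h₂ hlt ↦ ?_⟩
  obtain ⟨c, a, b, hc, ha, hb, hcU⟩ := hlocal t₁ ht₁ t₂ ht₂ h₁ h₂ hlt
  exact ⟨Φ ∘ c, a, b, hΦ.isCausalArc hc, congrArg Φ ha, congrArg Φ hb, hcU⟩

theorem causallyJoined (hΦ : g.IsCausalMap h Φ) {p q : V} (hpq : g.CausallyJoined p q) :
    h.CausallyJoined (Φ p) (Φ q) := by
  obtain ⟨γ, a, b, hab, hγ, rfl, rfl⟩ := hpq
  exact ⟨Φ ∘ γ, a, b, hab, hΦ.isCausalCurve hγ, rfl, rfl⟩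

theorem isAcausal_preimage (hΦ : g.IsCausalMap h Φ) {S : Set W} (hS : h.IsAcausal S) :
    g.IsAcausal (Φ ⁻¹' S) :=
  fun _ hp _ hq hpq ↦ hS _ hp _ hq (hΦ.causallyJoined hpq)

theorem causal (hΦ : g.IsCausalMap h Φ) (hinj : Function.Injective Φ) (hh : h.Causal) :
    g.Causal := by
  refine fun x ↦ Subset.antisymm (fun y hy ↦ hinj ?_)
    (singleton_subset_iff.2 ⟨Or.inl rfl, Or.inl rfl⟩)
  have hΦy : Φ y ∈ h.causalFuture (Φ x) ∩ h.causalPast (Φ x) :=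
    hy.imp (Or.imp (congrArg Φ) hΦ.causallyJoined) (Or.imp (congrArg Φ) hΦ.causallyJoined)
  rwa [hh (Φ x)] at hΦy

theorem stronglyCausal (hΦ : g.IsCausalMap h Φ) (hind : Topology.IsInducing Φ)
    (hh : h.StronglyCausal) : g.StronglyCausal := by
  intro x N hN
  obtain ⟨N', hN', hN'N⟩ := (hind.nhds_eq_comap x ▸ hN : N ∈ Filter.comap Φ (𝓝 (Φ x)))
  obtain ⟨U, hU, hUN', hconn⟩ := hh (Φ x) N' hN'
  refine ⟨Φ ⁻¹' U, hind.continuous.continuousAt.preimage_mem_nhds hU,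
    (preimage_mono hUN').trans hN'N, fun γ s hγ ↦ ?_⟩
  have himage : Φ '' (γ '' s ∩ Φ ⁻¹' U) = (Φ ∘ γ) '' s ∩ U := by
    rw [image_inter_preimage, image_comp]
  refine (hconn (Φ ∘ γ) s (hΦ.isCausalCurve hγ)).imp (fun hempty ↦ ?_) fun hc ↦ ?_
  · rwa [← himage, image_eq_empty] at hempty
  · rw [← himage] at hc
    exact ⟨hc.nonempty.of_image, hind.isPreconnected_image.1 hc.isPreconnected⟩

theorem causallyStable (hΦ : g.IsCausalMap h Φ) (hsmooth : ContMDiff (𝓡 m) (𝓡 n) ∞ Φ)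
    (hh : h.CausallyStable) : g.CausallyStable := by
  rw [causallyStable_iff] at hh ⊢
  obtain ⟨f, hf, hdf⟩ := hh
  refine ⟨f ∘ Φ, hf.comp hsmooth, fun x v hv ↦ ?_⟩
  rw [mfderiv_comp x (hf.mdifferentiableAt (by simp)) (hsmooth.mdifferentiableAt (by simp))]
  exact hdf _ _ (hΦ.isFuture_mfderiv hv)

end IsCausalMap

end CausalMap

section Homeomorph

variable {n : ℕ}
  {V : Type*} [TopologicalSpace V] [ChartedSpace (EuclideanSpace ℝ (Fin n)) V]
  [IsManifold (𝓡 n) ∞ V]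
  {W : Type*} [TopologicalSpace W] [ChartedSpace (EuclideanSpace ℝ (Fin n)) W]
  [IsManifold (𝓡 n) ∞ W] {g : Spacetime n V} {h : Spacetime n W} {Φ : V ≃ₜ W}

theorem IsCausalMap.preimage_development_subset (hΦ : g.IsCausalMap h Φ) (S : Set W) :
    Φ ⁻¹' h.development S ⊆ g.development (Φ ⁻¹' S) := by
  have hsymm : ∀ γ : ℝ → V, Φ.symm ∘ Φ ∘ γ = γ := fun γ ↦ funext fun t ↦ Φ.symm_apply_apply (γ t)
  rintro x (hx | hx)
  · refine .inl fun γ s hγ hend ⟨t, ht, htx⟩ ↦ ?_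
    refine hx (Φ ∘ γ) s (hΦ.isCausalCurve hγ) (fun ⟨y, hy⟩ ↦ hend ⟨Φ.symm y, ?_⟩)
      ⟨t, ht, congrArg Φ htx⟩
    exact hsymm γ ▸ hy.map Φ.symm.continuous.continuousAt
  · refine .inr fun γ s hγ hend ⟨t, ht, htx⟩ ↦ ?_
    refine hx (Φ ∘ γ) s (hΦ.isCausalCurve hγ) (fun ⟨y, hy⟩ ↦ hend ⟨Φ.symm y, ?_⟩)
      ⟨t, ht, congrArg Φ htx⟩
    exact hsymm γ ▸ hy.map Φ.symm.continuous.continuousAt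

theorem IsCausalMap.globallyHyperbolic (hΦ : g.IsCausalMap h Φ) (hΦt : g.IsTimelikeMap h Φ)
    (hh : h.GloballyHyperbolic) : g.GloballyHyperbolic := by
  obtain ⟨S, hS, hacausal, hedge, hdev⟩ := hh
  refine ⟨Φ ⁻¹' S, hS.preimage_homeomorph Φ, hΦ.isAcausal_preimage hacausal, ?_, ?_⟩
  · simpa only [hedge, preimage_empty, subset_empty_iff] using hΦt.edge_preimage_subset S
  · simpa only [hdev, preimage_univ, univ_subset_iff] using hΦ.preimage_development_subset S

end Homeomorph

end

end Spacetime

theorem theorem4p3_general {n : ℕ}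
    {V : Type*} [TopologicalSpace V]
    [ChartedSpace (EuclideanSpace ℝ (Fin n)) V] [IsManifold (𝓡 n) ∞ V]
    {W : Type*} [TopologicalSpace W]
    [ChartedSpace (EuclideanSpace ℝ (Fin n)) W] [IsManifold (𝓡 n) ∞ W]
    {g : Spacetime n V} {h : Spacetime n W} (hgh : g.Precedes h) :
    (h.GloballyHyperbolic → g.GloballyHyperbolic) ∧
    (h.CausallyStable → g.CausallyStable) ∧
    (h.StronglyCausal → g.StronglyCausal) ∧
    (h.Distinguishing → g.Distinguishing) ∧
    (h.Causal → g.Causal) ∧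
    (h.Chronological → g.Chronological) ∧
    (h.NotTotallyVicious → g.NotTotallyVicious) := by
  obtain ⟨Φ, hfuture⟩ := hgh
  have hΦ : g.IsCausalMap h Φ.toHomeomorph :=
    ⟨Φ.contMDiff.of_le (by simp), fun {x v} hv ↦ hfuture x v hv⟩
  have hΦt : g.IsTimelikeMap h Φ.toHomeomorph := hΦ.isTimelikeMap fun x ↦
    (Φ.mfderivToContinuousLinearEquiv (by simp) x).surjective
  exact ⟨hΦ.globallyHyperbolic hΦt, hΦ.causallyStable Φ.contMDiff,
    hΦ.stronglyCausal Φ.toHomeomorph.isInducing, hΦt.distinguishing Φ.injective,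
    hΦ.causal Φ.injective, hΦt.chronological, hΦt.notTotallyVicious Φ.surjective⟩

theorem theorem4p3 {n : ℕ}
    {V : Type*} [TopologicalSpace V] [T2Space V] [ConnectedSpace V]
    [ChartedSpace (EuclideanSpace ℝ (Fin n)) V] [IsManifold (𝓡 n) ∞ V]
    {W : Type*} [TopologicalSpace W] [T2Space W] [ConnectedSpace W]
    [ChartedSpace (EuclideanSpace ℝ (Fin n)) W] [IsManifold (𝓡 n) ∞ W]
    (g : Spacetime n V) (h : Spacetime n W) :
    (g.Precedes h →
      (h.GloballyHyperbolic → g.GloballyHyperbolic) ∧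
      (h.CausallyStable → g.CausallyStable) ∧
      (h.StronglyCausal → g.StronglyCausal) ∧
      (h.Distinguishing → g.Distinguishing) ∧
      (h.Causal → g.Causal) ∧
      (h.Chronological → g.Chronological) ∧
      (h.NotTotallyVicious → g.NotTotallyVicious)) ∧
    ((h.GloballyHyperbolic ∧ ¬ g.GloballyHyperbolic) ∨
      (h.CausallyStable ∧ ¬ g.CausallyStable) ∨
      (h.StronglyCausal ∧ ¬ g.StronglyCausal) ∨
      (h.Distinguishing ∧ ¬ g.Distinguishing) ∨
      (h.Causal ∧ ¬ g.Causal) ∨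
      (h.Chronological ∧ ¬ g.Chronological) ∨
      (h.NotTotallyVicious ∧ ¬ g.NotTotallyVicious) →
        ¬ g.Precedes h) := by
  refine ⟨theorem4p3_general, fun hfail hgh ↦ ?_⟩
  have hpull := theorem4p3_general hgh
  grind only
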